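/- Rings are associative and need not be unital; ring homomorphisms are additive and multiplicative, and bimodules satisfy no unit condition. $\otimes$ is the $R$-balanced tensor product, $M^{\otimes 1}=M$ and $M^{\otimes n}=M^{\otimes n-1}\otimes M$ for $n>1$. "Linear" means additive, and $\operatorname{span}$ is the additive span. Let $R$ be a ring and $(P,Q,\psi)$ an $R$-system, i.e. $P,Q$ are $R$-bimodules and $\psi:P\otimes Q\to R$ is an $R$-bimodule homomorphism. A covariant representation $(S,T,\sigma,B)$ of $(P,Q,\psi)$ consists of a ring $B$, linear maps $S:P\to B$, $T:Q\to B$ and a ring homomorphism $\sigma:R\to B$ with $S(pr)=S(p)\sigma(r)$, $S(rp)=\sigma(r)S(p)$, $T(qr)=T(q)\sigma(r)$, $T(rq)=\sigma(r)T(q)$ and $\sigma(\psi(p\otimes q))=S(p)T(q)$ for all $r\in R$, $p\in P$, $q\in Q$. It is injective if $\sigma$ is injective, and surjective if $B$ is generated as a ring by $\sigma(R)\cup T(Q)\cup S(P)$. A morphism $(S_1,T_1,\sigma_1,B_1)\to(S_2,T_2,\sigma_2,B_2)$ is a ring homomorphism $\phi:B_1\to B_2$ with $\phi\circ S_1=S_2$,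 $\phi\circ T_1=T_2$, $\phi\circ\sigma_1=\sigma_2$. For $n\ge 1$ let $S^n:P^{\otimes n}\to B$ and $T^n:Q^{\otimes n}\to B$ be the linear maps with $S^n(p_1\otimes\dots\otimes p_n)=S(p_1)\cdots S(p_n)$ and $T^n(q_1\otimes\dots\otimes q_n)=T(q_1)\cdots T(q_n)$. Let $\mathscr S$ be the semigroup $\mathbb N_0^2$ with $(m,n)(k,l)=(m,n-k+l)$ if $n\ge k$ and $(m,n)(k,l)=(m+k-n,l)$ if $k\ge n$. An $\mathscr S$-grading of a ring $B$ is a family $(\mathcal Y_s)_{s\in\mathscr S}$ of additive subgroups such that $B=\bigoplus_{s}\mathcal Y_s$ and $\mathcal Y_s\mathcal Y_t\subseteq\mathcal Y_{st}$ for all $s,t\in\mathscr S$. **Theorem.** For every ring $R$ and every $R$-system $(P,Q,\psi)$ there exists an injective and surjective covariant representation $(\iota_P,\iota_Q,\iota_R,\mathcal T_{(P,Q,\psi)})$ with the following property: (TP) For every covariant representation $(S,T,\sigma,B)$ of $(P,Q,\psi)$ there is a unique ring homomorphism $\eta:\mathcal T_{(P,Q,\psi)}\to B$ with $\eta\circ\iota_R=\sigma$,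 $\eta\circ\iota_Q=T$ and $\eta\circ\iota_P=S$. Moreover, every surjective covariant representation of $(P,Q,\psi)$ with property (TP) is isomorphic to $(\iota_P,\iota_Q,\iota_R,\mathcal T_{(P,Q,\psi)})$; in fact, if $(S,T,\sigma,B)$ is a surjective covariant representation and $\phi:B\to\mathcal T_{(P,Q,\psi)}$ is a ring homomorphism with $\phi\circ\sigma=\iota_R$, $\phi\circ S=\iota_P$ and $\phi\circ T=\iota_Q$, then $\phi$ is an isomorphism. For $m,n\ge 1$ let $\mathcal T_{(m,n)}=\operatorname{span}\{\iota_Q^m(q)\iota_P^n(p)\mid q\in Q^{\otimes m},\,p\in P^{\otimes n}\}$, for $k\ge1$ let $\mathcal T_{(k,0)}=\iota_Q^k(Q^{\otimes k})$ and $\mathcal T_{(0,k)}=\iota_P^k(P^{\otimes k})$, and let $\mathcal T_{(0,0)}=\iota_R(R)$. Then $(\mathcal T_{(m,n)})_{(m,n)\in\mathscr S}$ is an $\mathscr S$-grading of $\mathcal T_{(P,Q,\psi)}$, and it is the only $\mathscr S$-grading $(\mathcal Y_{(m,n)})_{(m,n)\in\mathscr S}$ of $\mathcal T_{(P,Q,\psi)}$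 with $\iota_R(R)\subseteq\mathcal Y_{(0,0)}$, $\iota_Q(Q)\subseteq\mathcal Y_{(1,0)}$ and $\iota_P(P)\subseteq\mathcal Y_{(0,1)}$. -/

import Mathlib

/-! Rings are associative and need not have a unit; ring homomorphisms are additive and
multiplicative.  Modules over such rings satisfy no unit condition. -/

universe u v w x y

/-- An `R`-bimodule structure on the abelian group `M`, for a ring `R` that need not have a unit.
`lact r m` is `r m` and `ract m r` is `m r`. -/
class Bimodule (R : Type u) [NonUnitalRing R] (M : Type v) [AddCommGroup M] where
  lact : R → M → M
  ract : M → R → M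
  lact_add : ∀ (r : R) (m n : M), lact r (m + n) = lact r m + lact r n
  add_lact : ∀ (r s : R) (m : M), lact (r + s) m = lact r m + lact s m
  mul_lact : ∀ (r s : R) (m : M), lact (r * s) m = lact r (lact s m)
  add_ract : ∀ (m n : M) (r : R), ract (m + n) r = ract m r + ract n r
  ract_add : ∀ (m : M) (r s : R), ract m (r + s) = ract m r + ract m s
  ract_mul : ∀ (m : M) (r s : R), ract m (r * s) = ract (ract m r) s
  lact_ract : ∀ (r : R) (m : M) (s : R), ract (lact r m) s = lact r (ract m s)

/-- A ring as a bimodule over itself. -/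
instance Bimodule.self (R : Type u) [NonUnitalRing R] : Bimodule R R where
  lact r m := r * m
  ract m r := m * r
  lact_add := mul_add
  add_lact := add_mul
  mul_lact := mul_assoc
  add_ract := add_mul
  ract_add := mul_add
  ract_mul m r s := (mul_assoc m r s).symm
  lact_ract := mul_assoc

namespace Bimodule

/-- Left multiplication by `r` as an additive map. -/
def lactHom {R : Type u} [NonUnitalRing R] (M : Type v) [AddCommGroup M] [Bimodule R M] (r : R) :
    M →+ M :=
  AddMonoidHom.mk' (fun m => lact r m) (lact_add r)

/-- Right multiplication by `r` as an additive map. -/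
def ractHom {R : Type u} [NonUnitalRing R] (M : Type v) [AddCommGroup M] [Bimodule R M] (r : R) :
    M →+ M :=
  AddMonoidHom.mk' (fun m => ract m r) (fun m n => add_ract m n r)

end Bimodule

/-- Homomorphisms of `R`-bimodules. -/
structure BimoduleHom (R : Type u) [NonUnitalRing R] (M : Type v) [AddCommGroup M] [Bimodule R M]
    (N : Type w) [AddCommGroup N] [Bimodule R N] extends M →+ N where
  map_lact : ∀ (r : R) (m : M), toFun (Bimodule.lact r m) = Bimodule.lact r (toFun m)
  map_ract : ∀ (m : M) (r : R), toFun (Bimodule.ract m r) = Bimodule.ract (toFun m) r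

/-! ### The balanced tensor product -/

/-- The subgroup of `M ⊗_ℤ N` generated by the elements `m r ⊗ n - m ⊗ r n`. -/
def balancedSubgroup (R : Type u) [NonUnitalRing R] (M : Type v) [AddCommGroup M] [Bimodule R M]
    (N : Type w) [AddCommGroup N] [Bimodule R N] : AddSubgroup (TensorProduct ℤ M N) :=
  AddSubgroup.closure {t | ∃ (m : M) (r : R) (n : N),
    t = TensorProduct.tmul ℤ (Bimodule.ract m r) n - TensorProduct.tmul ℤ m (Bimodule.lact r n)}

/-- The `R`-balanced tensor product `M ⊗_R N`. -/
def BTensor (R : Type u) [NonUnitalRing R] (M : Type v) [AddCommGroup M] [Bimodule R M]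
    (N : Type w) [AddCommGroup N] [Bimodule R N] : Type (max v w) :=
  TensorProduct ℤ M N ⧸ balancedSubgroup R M N

namespace BTensor

variable {R : Type u} [NonUnitalRing R] {M : Type v} [AddCommGroup M] [Bimodule R M]
  {N : Type w} [AddCommGroup N] [Bimodule R N]

instance : AddCommGroup (BTensor R M N) :=
  inferInstanceAs (AddCommGroup (TensorProduct ℤ M N ⧸ balancedSubgroup R M N))

/-- The quotient map `M ⊗_ℤ N → M ⊗_R N`. -/
def mk (R : Type u) [NonUnitalRing R] (M : Type v) [AddCommGroup M] [Bimodule R M]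
    (N : Type w) [AddCommGroup N] [Bimodule R N] : TensorProduct ℤ M N →+ BTensor R M N :=
  QuotientAddGroup.mk' (balancedSubgroup R M N)

/-- The elementary tensor `m ⊗ n`. -/
def tmul (R : Type u) [NonUnitalRing R] [Bimodule R M] [Bimodule R N] (m : M) (n : N) :
    BTensor R M N :=
  mk R M N (TensorProduct.tmul ℤ m n)

/-- The additive map on `M ⊗_R N` induced by a balanced biadditive map. -/
def lift {A : Type x} [AddCommGroup A] (f : M →+ N →+ A)
    (hf : ∀ (m : M) (r : R) (n : N), f (Bimodule.ract m r) n = f m (Bimodule.lact r n)) :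
    BTensor R M N →+ A :=
  QuotientAddGroup.lift (balancedSubgroup R M N)
    (TensorProduct.liftAddHom f (fun z m n => by simp))
    (by
      unfold balancedSubgroup
      rw [AddSubgroup.closure_le]
      rintro _ ⟨m, r, n, rfl⟩
      simp [hf])

theorem lift_tmul {A : Type x} [AddCommGroup A] (f : M →+ N →+ A)
    (hf : ∀ (m : M) (r : R) (n : N), f (Bimodule.ract m r) n = f m (Bimodule.lact r n))
    (m : M) (n : N) : lift f hf (tmul R m n) = f m n := rfl

theorem hom_ext {A : Type x} [AddCommGroup A] {f g : BTensor R M N →+ A}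
    (h : ∀ (m : M) (n : N), f (tmul R m n) = g (tmul R m n)) : f = g := by
  apply QuotientAddGroup.addMonoidHom_ext
  ext t
  induction t using TensorProduct.induction_on with
  | zero => simp
  | tmul m n => exact h m n
  | add a b ha hb => rw [map_add, map_add, ha, hb]

theorem hom_ext_apply {A : Type x} [AddCommGroup A] (f g : BTensor R M N →+ A)
    (h : ∀ (m : M) (n : N), f (tmul R m n) = g (tmul R m n)) (t : BTensor R M N) : f t = g t := by
  rw [hom_ext h]

theorem add_tmul (m m' : M) (n : N) : tmul R (m + m') n = tmul R m n + tmul R m' n := by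
  unfold tmul; rw [TensorProduct.add_tmul, map_add]

theorem tmul_add (m : M) (n n' : N) : tmul R m (n + n') = tmul R m n + tmul R m n' := by
  unfold tmul; rw [TensorProduct.tmul_add, map_add]

theorem ract_tmul (m : M) (r : R) (n : N) :
    tmul R (Bimodule.ract m r) n = tmul R m (Bimodule.lact r n) := by
  rw [← sub_eq_zero]
  unfold tmul
  rw [← map_sub]
  exact (QuotientAddGroup.eq_zero_iff _).2 (AddSubgroup.subset_closure ⟨m, r, n, rfl⟩)

/-- The biadditive map `(m, n) ↦ m ⊗ n`. -/
def mkHom (R : Type u) [NonUnitalRing R] (M : Type v) [AddCommGroup M] [Bimodule R M]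
    (N : Type w) [AddCommGroup N] [Bimodule R N] : M →+ N →+ BTensor R M N :=
  AddMonoidHom.mk' (fun m => AddMonoidHom.mk' (fun n => tmul R m n) (tmul_add m))
    (fun m m' => by ext n; exact add_tmul m m' n)

/-- The map `m ⊗ n ↦ r m ⊗ n`. -/
def lactMap (R : Type u) [NonUnitalRing R] (M : Type v) [AddCommGroup M] [Bimodule R M]
    (N : Type w) [AddCommGroup N] [Bimodule R N] (r : R) : BTensor R M N →+ BTensor R M N :=
  lift ((mkHom R M N).comp (Bimodule.lactHom M r)) (fun m s n => by
    change tmul R (Bimodule.lact r (Bimodule.ract m s)) n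
      = tmul R (Bimodule.lact r m) (Bimodule.lact s n)
    rw [← Bimodule.lact_ract, ract_tmul])

/-- The map `m ⊗ n ↦ m ⊗ n r`. -/
def ractMap (R : Type u) [NonUnitalRing R] (M : Type v) [AddCommGroup M] [Bimodule R M]
    (N : Type w) [AddCommGroup N] [Bimodule R N] (r : R) : BTensor R M N →+ BTensor R M N :=
  lift ((mkHom R M N).compl₂ (Bimodule.ractHom N r)) (fun m s n => by
    change tmul R (Bimodule.ract m s) (Bimodule.ract n r)
      = tmul R m (Bimodule.ract (Bimodule.lact s n) r)
    rw [Bimodule.lact_ract, ract_tmul])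

theorem lactMap_tmul (r : R) (m : M) (n : N) :
    lactMap R M N r (tmul R m n) = tmul R (Bimodule.lact r m) n := rfl

theorem ractMap_tmul (r : R) (m : M) (n : N) :
    ractMap R M N r (tmul R m n) = tmul R m (Bimodule.ract n r) := rfl

/-- The bimodule structure `r (m ⊗ n) = r m ⊗ n`, `(m ⊗ n) r = m ⊗ n r`. -/
instance : Bimodule R (BTensor R M N) where
  lact r t := lactMap R M N r t
  ract t r := ractMap R M N r t
  lact_add r := map_add _
  add_lact r s := hom_ext_apply _ (lactMap R M N r + lactMap R M N s) fun m n => by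
    simp only [AddMonoidHom.add_apply, lactMap_tmul, Bimodule.add_lact, add_tmul]
  mul_lact r s := hom_ext_apply _ ((lactMap R M N r).comp (lactMap R M N s)) fun m n => by
    simp only [AddMonoidHom.comp_apply, lactMap_tmul, Bimodule.mul_lact]
  add_ract t t' r := map_add _ t t'
  ract_add t r s := hom_ext_apply _ (ractMap R M N r + ractMap R M N s) (fun m n => by
    simp only [AddMonoidHom.add_apply, ractMap_tmul, Bimodule.ract_add, tmul_add]) t
  ract_mul t r s := hom_ext_apply _ ((ractMap R M N s).comp (ractMap R M N r)) (fun m n => by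
    simp only [AddMonoidHom.comp_apply, ractMap_tmul, Bimodule.ract_mul]) t
  lact_ract r t s := hom_ext_apply ((ractMap R M N s).comp (lactMap R M N r))
    ((lactMap R M N r).comp (ractMap R M N s)) (fun _ _ => rfl) t

end BTensor

/-! ### Tensor powers -/

/-- A bimodule bundled with its carrier. -/
structure BundledBimodule (R : Type u) [NonUnitalRing R] where
  carrier : Type v
  [addCommGroup : AddCommGroup carrier]
  [bimodule : Bimodule R carrier]

attribute [instance] BundledBimodule.addCommGroup BundledBimodule.bimodule

/-- `bundledTPow R M n` is `M^{⊗ (n+1)}`, where `M^{⊗ 1} = M` and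
`M^{⊗ (k+1)} = M^{⊗ k} ⊗_R M`. -/
def bundledTPow (R : Type u) [NonUnitalRing R] (M : Type v) [AddCommGroup M] [Bimodule R M] :
    ℕ → BundledBimodule.{u, v} R
  | 0 => ⟨M⟩
  | n + 1 => ⟨BTensor R (bundledTPow R M n).carrier M⟩

/-- `TPow R M n` is the tensor power `M^{⊗ (n+1)}` (note the shift). -/
def TPow (R : Type u) [NonUnitalRing R] (M : Type v) [AddCommGroup M] [Bimodule R M] (n : ℕ) :
    Type v :=
  (bundledTPow R M n).carrier

instance (R : Type u) [NonUnitalRing R] (M : Type v) [AddCommGroup M] [Bimodule R M] (n : ℕ) :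
    AddCommGroup (TPow R M n) :=
  (bundledTPow R M n).addCommGroup

instance (R : Type u) [NonUnitalRing R] (M : Type v) [AddCommGroup M] [Bimodule R M] (n : ℕ) :
    Bimodule R (TPow R M n) :=
  (bundledTPow R M n).bimodule

/-- Let `f : M → B` be additive with `f (m r) = f m * σ r` and `f (r m) = σ r * f m`.
This is the additive map `M^{⊗ (n+1)} → B`, `m₁ ⊗ ⋯ ⊗ mₙ₊₁ ↦ f m₁ * ⋯ * f mₙ₊₁`,
together with its compatibility with the right action, which the recursion needs. -/
def powMapAux {R : Type u} [NonUnitalRing R] {M : Type v} [AddCommGroup M] [Bimodule R M]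
    {B : Type w} [NonUnitalRing B] (σ : R →ₙ+* B) (f : M →+ B)
    (hr : ∀ (m : M) (r : R), f (Bimodule.ract m r) = f m * σ r)
    (hl : ∀ (r : R) (m : M), f (Bimodule.lact r m) = σ r * f m) :
    (n : ℕ) → {g : TPow R M n →+ B // ∀ (t : TPow R M n) (r : R),
      g (Bimodule.ract t r) = g t * σ r}
  | 0 => ⟨f, hr⟩
  | n + 1 =>
    let g := powMapAux σ f hr hl n
    let h : BTensor R (TPow R M n) M →+ B :=
      BTensor.lift ((AddMonoidHom.mul.comp g.1).compl₂ f) (fun t r m => by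
        change g.1 (Bimodule.ract t r) * f m = g.1 t * f (Bimodule.lact r m)
        rw [g.2, hl, mul_assoc])
    ⟨h, fun t r => BTensor.hom_ext_apply (h.comp (BTensor.ractMap R (TPow R M n) M r))
      ((AddMonoidHom.mulRight (σ r)).comp h) (fun s m => by
        change g.1 s * f (Bimodule.ract m r) = g.1 s * f m * σ r
        rw [hr, mul_assoc]) t⟩

/-- The additive map `M^{⊗ (n+1)} → B`, `m₁ ⊗ ⋯ ⊗ mₙ₊₁ ↦ f m₁ * ⋯ * f mₙ₊₁`. -/
def powMap {R : Type u} [NonUnitalRing R] {M : Type v} [AddCommGroup M] [Bimodule R M]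
    {B : Type w} [NonUnitalRing B] (σ : R →ₙ+* B) (f : M →+ B)
    (hr : ∀ (m : M) (r : R), f (Bimodule.ract m r) = f m * σ r)
    (hl : ∀ (r : R) (m : M), f (Bimodule.lact r m) = σ r * f m) (n : ℕ) : TPow R M n →+ B :=
  (powMapAux σ f hr hl n).1

theorem powMap_zero {R : Type u} [NonUnitalRing R] {M : Type v} [AddCommGroup M] [Bimodule R M]
    {B : Type w} [NonUnitalRing B] (σ : R →ₙ+* B) (f : M →+ B)
    (hr : ∀ (m : M) (r : R), f (Bimodule.ract m r) = f m * σ r)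
    (hl : ∀ (r : R) (m : M), f (Bimodule.lact r m) = σ r * f m) (m : M) :
    powMap σ f hr hl 0 m = f m := rfl

theorem powMap_succ {R : Type u} [NonUnitalRing R] {M : Type v} [AddCommGroup M] [Bimodule R M]
    {B : Type w} [NonUnitalRing B] (σ : R →ₙ+* B) (f : M →+ B)
    (hr : ∀ (m : M) (r : R), f (Bimodule.ract m r) = f m * σ r)
    (hl : ∀ (r : R) (m : M), f (Bimodule.lact r m) = σ r * f m) (n : ℕ) (t : TPow R M n) (m : M) :
    powMap σ f hr hl (n + 1) (BTensor.tmul R t m) = powMap σ f hr hl n t * f m := rfl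

/-! ### Covariant representations -/

/-- A covariant representation `(S, T, σ, B)` of the `R`-system `(P, Q, ψ)` on the ring `B`. -/
structure CovariantRep {R : Type u} [NonUnitalRing R] {P : Type v} [AddCommGroup P] [Bimodule R P]
    {Q : Type w} [AddCommGroup Q] [Bimodule R Q] (ψ : BimoduleHom R (BTensor R P Q) R)
    (B : Type x) [NonUnitalRing B] where
  S : P →+ B
  T : Q →+ B
  σ : R →ₙ+* B
  S_ract : ∀ (p : P) (r : R), S (Bimodule.ract p r) = S p * σ r
  S_lact : ∀ (r : R) (p : P), S (Bimodule.lact r p) = σ r * S p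
  T_ract : ∀ (q : Q) (r : R), T (Bimodule.ract q r) = T q * σ r
  T_lact : ∀ (r : R) (q : Q), T (Bimodule.lact r q) = σ r * T q
  covariant : ∀ (p : P) (q : Q), σ (ψ.toAddMonoidHom (BTensor.tmul R p q)) = S p * T q

/-- The semigroup `ℕ₀²` that indexes the grading. -/
@[ext]
structure SIndex where
  fst : ℕ
  snd : ℕ
  deriving DecidableEq

/-- `(m, n)(k, l) = (m, n - k + l)` if `n ≥ k`, and `(m + k - n, l)` if `k ≥ n`. -/
instance : Semigroup SIndex where
  mul a b := if b.fst ≤ a.snd then ⟨a.fst, a.snd - b.fst + b.snd⟩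
    else ⟨a.fst + b.fst - a.snd, b.snd⟩
  mul_assoc := by
    rintro ⟨a, b⟩ ⟨c, d⟩ ⟨e, f⟩
    simp only [HMul.hMul]
    ext <;> split_ifs <;> dsimp only at * <;> omega

/-- `𝒴` is an `𝒮`-grading of the ring `B`: `B` is the (internal) direct sum of the additive
subgroups `𝒴 s`, and `𝒴 s · 𝒴 t ⊆ 𝒴 (s t)`. -/
structure IsSGrading {B : Type x} [NonUnitalRing B] (𝒴 : SIndex → AddSubgroup B) : Prop where
  isInternal : DirectSum.IsInternal 𝒴
  mul_mem : ∀ (s t : SIndex) (a b : B), a ∈ 𝒴 s → b ∈ 𝒴 t → a * b ∈ 𝒴 (s * t)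

namespace CovariantRep

variable {R : Type u} [NonUnitalRing R] {P : Type v} [AddCommGroup P] [Bimodule R P]
    {Q : Type w} [AddCommGroup Q] [Bimodule R Q] {ψ : BimoduleHom R (BTensor R P Q) R}

/-- The representation of `R` is injective. -/
def IsInjective {B : Type x} [NonUnitalRing B] (ρ : CovariantRep ψ B) : Prop :=
  Function.Injective ρ.σ

/-- `B` is generated as a ring by `σ(R) ∪ T(Q) ∪ S(P)`. -/
def IsSurjective {B : Type x} [NonUnitalRing B] (ρ : CovariantRep ψ B) : Prop :=
  NonUnitalSubring.closure (Set.range ρ.σ ∪ Set.range ρ.T ∪ Set.range ρ.S) = ⊤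

/-- `φ` is a morphism from the representation `ρ₁` to the representation `ρ₂`. -/
structure IsMorphism {B₁ : Type*} [NonUnitalRing B₁] {B₂ : Type*} [NonUnitalRing B₂]
    (ρ₁ : CovariantRep ψ B₁) (ρ₂ : CovariantRep ψ B₂) (φ : B₁ →ₙ+* B₂) : Prop where
  comp_T : ∀ q : Q, φ (ρ₁.T q) = ρ₂.T q
  comp_S : ∀ p : P, φ (ρ₁.S p) = ρ₂.S p
  comp_σ : ∀ r : R, φ (ρ₁.σ r) = ρ₂.σ r

/-- `φ` is an isomorphism of representations: a morphism with an inverse morphism. -/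
def IsIsomorphism {B₁ : Type*} [NonUnitalRing B₁] {B₂ : Type*} [NonUnitalRing B₂]
    (ρ₁ : CovariantRep ψ B₁) (ρ₂ : CovariantRep ψ B₂) (φ : B₁ →ₙ+* B₂) : Prop :=
  IsMorphism ρ₁ ρ₂ φ ∧ ∃ χ : B₂ →ₙ+* B₁, IsMorphism ρ₂ ρ₁ χ ∧
    χ.comp φ = NonUnitalRingHom.id B₁ ∧ φ.comp χ = NonUnitalRingHom.id B₂

/-- The universal property against all covariant representations on rings in `Type x`. -/
def IsUniversal {A : Type y} [NonUnitalRing A] (τ : CovariantRep ψ A) : Prop :=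
  ∀ (B : Type x) [NonUnitalRing B] (ρ : CovariantRep ψ B), ∃! η : A →ₙ+* B, IsMorphism τ ρ η

/-- `ρ.Spow n` is the map `S^{n+1} : P^{⊗ (n+1)} → B`. -/
def Spow {B : Type x} [NonUnitalRing B] (ρ : CovariantRep ψ B) (n : ℕ) : TPow R P n →+ B :=
  powMap ρ.σ ρ.S ρ.S_ract ρ.S_lact n

/-- `ρ.Tpow n` is the map `T^{n+1} : Q^{⊗ (n+1)} → B`. -/
def Tpow {B : Type x} [NonUnitalRing B] (ρ : CovariantRep ψ B) (n : ℕ) : TPow R Q n →+ B :=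
  powMap ρ.σ ρ.T ρ.T_ract ρ.T_lact n

/-- The subgroup `σ(R)` in degree `(0,0)`, `T^k(Q^{⊗ k})` in degree `(k,0)`, `S^k(P^{⊗ k})` in
degree `(0,k)`, and the additive span of the products `T^m(q) S^n(p)` in degree `(m,n)`,
for `k, m, n ≥ 1`. -/
def component {B : Type x} [NonUnitalRing B] (ρ : CovariantRep ψ B) : SIndex → AddSubgroup B
  | ⟨0, 0⟩ => (ρ.σ : R →+ B).range
  | ⟨m + 1, 0⟩ => (ρ.Tpow m).range
  | ⟨0, n + 1⟩ => (ρ.Spow n).range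
  | ⟨m + 1, n + 1⟩ => AddSubgroup.closure
      {b | ∃ (q : TPow R Q m) (p : TPow R P n), b = ρ.Tpow m q * ρ.Spow n p}

end CovariantRep

/-! The universal ring is presented by generators and relations. A free unital ring is divided by
the relations of a covariant representation, and the non-unital subring generated by the generators
is kept. A representation on `B` extends to the quotient with values in the unitization of `B`, and
on that subring its values lie in `B`. Surjective representations have at most one morphism to any
target, so opposite morphisms between two of them are mutually inverse (`IsMorphism.isIsomorphism`).

Injectivity of `σ` can be tested on any one injective representation, and the Fock representation is
one.

For the grading, give `σ`, `T`, `S` the degrees (0,0), (1,0), (0,1). The defining relations are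
homogeneous, so the universal property yields a homomorphism into a semigroup ring over 𝒮 that
records degrees (`gradedRep`). The elements it sends to homogeneous elements of degree `s` form an
independent multiplicative family `degree`. The components lie in every multiplicative family with
the generators in the right degrees (`component_le`), and they span (`IsSurjective.iSup_component`).
A spanning family inside an independent one equals it (`iSupIndep.eq_of_le_of_iSup_eq_top`). This
identifies `degree` with the components and also shows that the grading is unique. -/

namespace CovariantRep

variable {R : Type u} [NonUnitalRing R] {P : Type v} [AddCommGroup P] [Bimodule R P]
    {Q : Type w} [AddCommGroup Q] [Bimodule R Q] {ψ : BimoduleHom R (BTensor R P Q) R}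

/-! ### Surjective representations -/

theorem IsSurjective.induction {B : Type x} [NonUnitalRing B] {ρ : CovariantRep ψ B}
    (hρ : ρ.IsSurjective) {p : B → Prop} (hσ : ∀ r, p (ρ.σ r)) (hT : ∀ q, p (ρ.T q))
    (hS : ∀ q, p (ρ.S q)) (hz : p 0) (hadd : ∀ a b, p a → p b → p (a + b))
    (hneg : ∀ a, p a → p (-a)) (hmul : ∀ a b, p a → p b → p (a * b)) (a : B) : p a := by
  have ha : a ∈ NonUnitalSubring.closure
      (Set.range ρ.σ ∪ Set.range ρ.T ∪ Set.range ρ.S) := by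
    rw [show NonUnitalSubring.closure _ = ⊤ from hρ]; trivial
  induction ha using NonUnitalSubring.closure_induction with
  | mem b hb =>
    rcases hb with (⟨r, rfl⟩ | ⟨q, rfl⟩) | ⟨q, rfl⟩
    exacts [hσ r, hT q, hS q]
  | zero => exact hz
  | add a b _ _ ha hb => exact hadd a b ha hb
  | neg a _ ha => exact hneg a ha
  | mul a b _ _ ha hb => exact hmul a b ha hb

theorem IsSurjective.hom_eq {B : Type x} [NonUnitalRing B] {ρ : CovariantRep ψ B}
    (hρ : ρ.IsSurjective) {C : Type y} [NonUnitalRing C] {ρ' : CovariantRep ψ C}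
    {f g : B →ₙ+* C} (hf : IsMorphism ρ ρ' f) (hg : IsMorphism ρ ρ' g) : f = g := by
  ext a
  induction a using hρ.induction with
  | hσ r => rw [hf.comp_σ, hg.comp_σ]
  | hT r => rw [hf.comp_T, hg.comp_T]
  | hS r => rw [hf.comp_S, hg.comp_S]
  | hz => simp
  | hadd a b ha hb => simp [ha, hb]
  | hneg a ha => simp [ha]
  | hmul a b ha hb => simp [ha, hb]

theorem IsMorphism.id {B : Type x} [NonUnitalRing B] (ρ : CovariantRep ψ B) :
    IsMorphism ρ ρ (NonUnitalRingHom.id B) :=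
  ⟨fun _ => rfl, fun _ => rfl, fun _ => rfl⟩

theorem IsMorphism.comp {B₁ B₂ B₃ : Type*} [NonUnitalRing B₁] [NonUnitalRing B₂]
    [NonUnitalRing B₃] {ρ₁ : CovariantRep ψ B₁} {ρ₂ : CovariantRep ψ B₂}
    {ρ₃ : CovariantRep ψ B₃} {g : B₂ →ₙ+* B₃} {f : B₁ →ₙ+* B₂}
    (hg : IsMorphism ρ₂ ρ₃ g) (hf : IsMorphism ρ₁ ρ₂ f) : IsMorphism ρ₁ ρ₃ (g.comp f) where
  comp_T q := by simp [hf.comp_T, hg.comp_T]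
  comp_S q := by simp [hf.comp_S, hg.comp_S]
  comp_σ q := by simp [hf.comp_σ, hg.comp_σ]

/-- Morphisms in both directions between surjective representations are mutually inverse. -/
theorem IsMorphism.isIsomorphism {B₁ B₂ : Type*} [NonUnitalRing B₁] [NonUnitalRing B₂]
    {ρ₁ : CovariantRep ψ B₁} {ρ₂ : CovariantRep ψ B₂} (h₁ : ρ₁.IsSurjective)
    (h₂ : ρ₂.IsSurjective) {f : B₁ →ₙ+* B₂} {g : B₂ →ₙ+* B₁}
    (hf : IsMorphism ρ₁ ρ₂ f) (hg : IsMorphism ρ₂ ρ₁ g) : IsIsomorphism ρ₁ ρ₂ f :=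
  ⟨hf, g, hg, h₁.hom_eq (hg.comp hf) (.id ρ₁), h₂.hom_eq (hf.comp hg) (.id ρ₂)⟩

/-! ### The components -/

theorem Tpow_ract {B : Type x} [NonUnitalRing B] (ρ : CovariantRep ψ B) (n : ℕ)
    (t : TPow R Q n) (r : R) : ρ.Tpow n (Bimodule.ract t r) = ρ.Tpow n t * ρ.σ r :=
  (powMapAux ρ.σ ρ.T ρ.T_ract ρ.T_lact n).2 t r

theorem Spow_ract {B : Type x} [NonUnitalRing B] (ρ : CovariantRep ψ B) (n : ℕ)
    (t : TPow R P n) (r : R) : ρ.Spow n (Bimodule.ract t r) = ρ.Spow n t * ρ.σ r :=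
  (powMapAux ρ.σ ρ.S ρ.S_ract ρ.S_lact n).2 t r

end CovariantRep

theorem SIndex.mul_def (a b : SIndex) : a * b =
    if b.fst ≤ a.snd then ⟨a.fst, a.snd - b.fst + b.snd⟩
    else ⟨a.fst + b.fst - a.snd, b.snd⟩ := rfl

theorem BTensor.induction_on {R : Type u} [NonUnitalRing R] {M : Type v} [AddCommGroup M]
    [Bimodule R M] {N : Type w} [AddCommGroup N] [Bimodule R N] {p : BTensor R M N → Prop}
    (t : BTensor R M N) (hz : p 0) (ht : ∀ m n, p (tmul R m n))
    (hadd : ∀ a b, p a → p b → p (a + b)) : p t := by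
  obtain ⟨t, rfl⟩ := QuotientAddGroup.mk'_surjective (balancedSubgroup R M N) t
  induction t using TensorProduct.induction_on with
  | zero => rw [map_zero]; exact hz
  | tmul m n => exact ht m n
  | add a b ha hb => rw [map_add]; exact hadd _ _ ha hb

namespace CovariantRep

variable {R : Type u} [NonUnitalRing R] {P : Type v} [AddCommGroup P] [Bimodule R P]
    {Q : Type w} [AddCommGroup Q] [Bimodule R Q] {ψ : BimoduleHom R (BTensor R P Q) R}

/-! ### Minimality of the components -/

section

variable {B : Type x} [NonUnitalRing B] {ρ : CovariantRep ψ B} {𝒴 : SIndex → AddSubgroup B}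
  (hmul : ∀ (s t : SIndex) (a b : B), a ∈ 𝒴 s → b ∈ 𝒴 t → a * b ∈ 𝒴 (s * t))
  (hσ : ∀ r, ρ.σ r ∈ 𝒴 ⟨0, 0⟩) (hT : ∀ q, ρ.T q ∈ 𝒴 ⟨1, 0⟩) (hS : ∀ p, ρ.S p ∈ 𝒴 ⟨0, 1⟩)
include hmul

include hT in
theorem Tpow_mem (n : ℕ) (t : TPow R Q n) : ρ.Tpow n t ∈ 𝒴 ⟨n + 1, 0⟩ := by
  induction n with
  | zero => exact hT t
  | succ n ih =>
    induction t using BTensor.induction_on with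
    | hz => erw [map_zero]; exact zero_mem _
    | ht t q =>
      -- (n+1, 0)(1, 0) = (n+2, 0), which is the degree for `Tpow (n + 1)` because of the index
      -- shift.
      have := hmul _ _ _ _ (ih t) (hT q)
      simp only [SIndex.mul_def] at this
      exact this
    | hadd a b ha hb => erw [map_add]; exact add_mem ha hb

include hS in
theorem Spow_mem (n : ℕ) (t : TPow R P n) : ρ.Spow n t ∈ 𝒴 ⟨0, n + 1⟩ := by
  induction n with
  | zero => exact hS t
  | succ n ih =>
    induction t using BTensor.induction_on with
    | hz => erw [map_zero]; exact zero_mem _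
    | ht t q =>
      have := hmul _ _ _ _ (ih t) (hS q)
      simp only [SIndex.mul_def] at this
      exact this
    | hadd a b ha hb => erw [map_add]; exact add_mem ha hb

include hσ hT hS in
/-- The components are the least multiplicative family that has the generators in the right
degrees. -/
theorem component_le (s : SIndex) : ρ.component s ≤ 𝒴 s := by
  obtain ⟨_ | m, _ | n⟩ := s
  · rintro _ ⟨r, rfl⟩; exact hσ r
  · rintro _ ⟨t, rfl⟩; exact Spow_mem hmul hS n t
  · rintro _ ⟨t, rfl⟩; exact Tpow_mem hmul hT m t
  · refine (AddSubgroup.closure_le _).2 ?_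
    rintro _ ⟨q, p, rfl⟩
    have := hmul _ _ _ _ (Tpow_mem hmul hT m q) (Spow_mem hmul hS n p)
    simpa [SIndex.mul_def] using this

end

/-! ### The components span a surjective representation -/

section

variable {B : Type x} [NonUnitalRing B] (ρ : CovariantRep ψ B)

theorem component_mul_σ (s : SIndex) {a : B} (ha : a ∈ ρ.component s) (r : R) :
    a * ρ.σ r ∈ ρ.component s := by
  obtain ⟨_ | m, _ | n⟩ := s
  · obtain ⟨r', rfl⟩ := ha; exact ⟨r' * r, map_mul ρ.σ r' r⟩
  · obtain ⟨t, rfl⟩ := ha; exact ⟨_, ρ.Spow_ract n t r⟩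
  · obtain ⟨t, rfl⟩ := ha; exact ⟨_, ρ.Tpow_ract m t r⟩
  · induction ha using AddSubgroup.closure_induction with
    | mem a ha =>
      obtain ⟨q, p, rfl⟩ := ha
      exact AddSubgroup.subset_closure ⟨q, _, by rw [ρ.Spow_ract, mul_assoc]⟩
    | zero => rw [zero_mul]; exact zero_mem _
    | add a b _ _ ha hb => rw [add_mul]; exact add_mem ha hb
    | neg a _ ha => rw [neg_mul]; exact neg_mem ha

theorem component_mul_S (s : SIndex) {a : B} (ha : a ∈ ρ.component s) (p : P) :
    a * ρ.S p ∈ ρ.component (s * ⟨0, 1⟩) := by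
  obtain ⟨_ | m, _ | n⟩ := s
  · obtain ⟨r, rfl⟩ := ha; exact ⟨_, ρ.S_lact r p⟩
  · obtain ⟨t, rfl⟩ := ha; exact ⟨BTensor.tmul R t p, rfl⟩
  · obtain ⟨t, rfl⟩ := ha; exact AddSubgroup.subset_closure ⟨t, p, rfl⟩
  · induction ha using AddSubgroup.closure_induction with
    | mem a ha =>
      obtain ⟨q, t, rfl⟩ := ha
      exact AddSubgroup.subset_closure ⟨q, BTensor.tmul R t p, mul_assoc _ _ _⟩
    | zero => rw [zero_mul]; exact zero_mem _
    | add a b _ _ ha hb => rw [add_mul]; exact add_mem ha hb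
    | neg a _ ha => rw [neg_mul]; exact neg_mem ha

/-- Covariance contracts the last factor from `P` with `q` to an element of `R`, which the right
action absorbs into the remaining factors. Since `Spow n` has n+1 factors, n remain, and for n = 0
the result lies in `σ(R)`. -/
theorem Spow_mul_T_mem (n : ℕ) (t : TPow R P n) (q : Q) :
    ρ.Spow n t * ρ.T q ∈ ρ.component ⟨0, n⟩ := by
  cases n with
  | zero => exact ⟨_, ρ.covariant t q⟩
  | succ n =>
    induction t using BTensor.induction_on with
    | hz => erw [map_zero, zero_mul]; exact zero_mem _
    | ht t p =>
      refine ⟨_, (ρ.Spow_ract n t (ψ.toAddMonoidHom (BTensor.tmul R p q))).trans ?_⟩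
      rw [ρ.covariant, ← mul_assoc]; rfl
    | hadd a b ha hb => erw [map_add, add_mul]; exact add_mem ha hb

theorem Tpow_mul_mem (m n : ℕ) (t : TPow R Q m) {a : B} (ha : a ∈ ρ.component ⟨0, n⟩) :
    ρ.Tpow m t * a ∈ ρ.component ⟨m + 1, n⟩ := by
  cases n with
  | zero => obtain ⟨r, rfl⟩ := ha; exact ⟨_, ρ.Tpow_ract m t r⟩
  | succ n => obtain ⟨p, rfl⟩ := ha; exact AddSubgroup.subset_closure ⟨t, p, rfl⟩

theorem component_mul_T (s : SIndex) {a : B} (ha : a ∈ ρ.component s) (q : Q) :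
    a * ρ.T q ∈ ρ.component (s * ⟨1, 0⟩) := by
  obtain ⟨_ | m, _ | n⟩ := s
  · obtain ⟨r, rfl⟩ := ha; exact ⟨_, ρ.T_lact r q⟩
  · obtain ⟨t, rfl⟩ := ha
    simpa [SIndex.mul_def] using ρ.Spow_mul_T_mem n t q
  · obtain ⟨t, rfl⟩ := ha; exact ⟨BTensor.tmul R t q, rfl⟩
  · simp only [SIndex.mul_def, le_add_iff_nonneg_left, zero_le, if_true, add_tsub_cancel_right,
      add_zero]
    induction ha using AddSubgroup.closure_induction with
    | mem a ha =>
      obtain ⟨t, p, rfl⟩ := ha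
      rw [mul_assoc]
      exact ρ.Tpow_mul_mem m n t (ρ.Spow_mul_T_mem n p q)
    | zero => rw [zero_mul]; exact zero_mem _
    | add a b _ _ ha hb => rw [add_mul]; exact add_mem ha hb
    | neg a _ ha => rw [neg_mul]; exact neg_mem ha

/-- The function `f` records how right multiplication by `b` moves degrees; only its existence
matters for the sum of the components. -/
theorem iSup_component_mul {b : B} {f : SIndex → SIndex}
    (hb : ∀ s, ∀ a ∈ ρ.component s, a * b ∈ ρ.component (f s)) {a : B}
    (ha : a ∈ ⨆ s, ρ.component s) : a * b ∈ ⨆ s, ρ.component s := by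
  have : (⨆ s, ρ.component s) ≤ (⨆ s, ρ.component s).comap (AddMonoidHom.mulRight b) :=
    iSup_le fun s c hc => AddSubgroup.mem_iSup_of_mem (f s) (hb s c hc)
  exact this ha

variable {ρ} in
theorem IsSurjective.iSup_component (hρ : ρ.IsSurjective) : ⨆ s, ρ.component s = ⊤ := by
  -- The elements `b` whose right multiplication preserves the sum form a subring, so it suffices to
  -- test generators. No product of two general components is needed.
  have key (b : B) : ∀ a ∈ ⨆ s, ρ.component s, a * b ∈ ⨆ s, ρ.component s := by
    induction b using hρ.induction with
    | hσ r => exact fun a => ρ.iSup_component_mul fun s a ha => ρ.component_mul_σ s ha r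
    | hT q => exact fun a => ρ.iSup_component_mul fun s a ha => ρ.component_mul_T s ha q
    | hS p => 
      exact fun a => ρ.iSup_component_mul fun s a ha => ρ.component_mul_S s ha p
    | hz => intro a _; rw [mul_zero]; exact zero_mem _
    | hadd b c hb hc => intro a ha; rw [mul_add]; exact add_mem (hb a ha) (hc a ha)
    | hneg b hb => intro a ha; rw [mul_neg]; exact neg_mem (hb a ha)
    | hmul b c hb hc => intro a ha; rw [← mul_assoc]; exact hc _ (hb a ha)
  refine eq_top_iff.2 fun a _ => ?_
  induction a using hρ.induction with
  | hσ r => exact AddSubgroup.mem_iSup_of_mem ⟨0, 0⟩ (show _ ∈ ρ.component ⟨0, 0⟩ from ⟨r, rfl⟩)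
  | hT q => exact AddSubgroup.mem_iSup_of_mem ⟨1, 0⟩ (show _ ∈ ρ.component ⟨1, 0⟩ from ⟨q, rfl⟩)
  | hS p => exact AddSubgroup.mem_iSup_of_mem ⟨0, 1⟩ (show _ ∈ ρ.component ⟨0, 1⟩ from ⟨p, rfl⟩)
  | hz => exact zero_mem _
  | hadd a b ha hb => exact add_mem (ha trivial) (hb trivial)
  | hneg a ha => exact neg_mem (ha trivial)
  | hmul a b ha hb => exact key b a (ha trivial)

end

end CovariantRep

/-- Split `a ∈ Y i` as `b + c` with `b ∈ Z i` and `c` in the sum of the other `Z j`. Then `c = a -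
b` lies in `Y i` and in the sum of the other `Y j`, so it vanishes. -/
theorem iSupIndep.eq_of_le_of_iSup_eq_top {ι : Type*} {A : Type*}
    [AddCommGroup A] {Y Z : ι → AddSubgroup A} (hY : iSupIndep Y) (hle : Z ≤ Y)
    (hZ : ⨆ i, Z i = ⊤) : Y = Z := by
  refine le_antisymm (fun i a ha => ?_) hle
  have hdisj := hY i
  have ha' : a ∈ Z i ⊔ ⨆ (j) (_ : j ≠ i), Z j := by
    rw [← iSup_split_single, hZ]; trivial
  obtain ⟨b, hb, c, hc, rfl⟩ := AddSubgroup.mem_sup.1 ha'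
  have hc' : c ∈ ⨆ (j) (_ : j ≠ i), Y j := (iSup₂_mono fun j _ => hle j) hc
  have hci : c ∈ Y i := by simpa using sub_mem ha (hle i hb)
  have : c = 0 := by simpa using hdisj.le_bot (show c ∈ Y i ⊓ _ from ⟨hci, hc'⟩)
  simpa [this] using hb

/-! ### The unitization over the integers -/

/-- The ring obtained from `A` by adjoining a unit. -/
def IntUnitization (A : Type u) : Type u := Unitization ℤ A

namespace IntUnitization

variable {A : Type u} [NonUnitalRing A]

instance : Ring (IntUnitization A) := inferInstanceAs (Ring (Unitization ℤ A))

/-- The inclusion of a ring into its unitization. -/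
def incl (A : Type u) [NonUnitalRing A] : A →ₙ+* IntUnitization A where
  toFun := Unitization.inr
  map_zero' := rfl
  map_add' := Unitization.inr_add ℤ
  map_mul' := Unitization.inr_mul ℤ

theorem incl_injective : Function.Injective (incl A) := Unitization.inr_injective

end IntUnitization

/-! ### The universal representation -/

namespace ToeplitzRing

open CovariantRep

section

variable {R : Type u} [NonUnitalRing R] {P : Type v} [AddCommGroup P] [Bimodule R P]
    {Q : Type w} [AddCommGroup Q] [Bimodule R Q] (ψ : BimoduleHom R (BTensor R P Q) R)

/-- The generators of the Toeplitz ring. -/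
inductive Gen (R : Type u) (P : Type v) (Q : Type w) : Type (max u v w)
  | σ (r : R)
  | S (p : P)
  | T (q : Q)

open FreeRing in
/-- The relations that hold between the generators in every covariant representation. -/
inductive Rel : FreeRing (Gen R P Q) → FreeRing (Gen R P Q) → Prop
  | σ_add (r s : R) : Rel (of (.σ (r + s))) (of (.σ r) + of (.σ s))
  | σ_mul (r s : R) : Rel (of (.σ (r * s))) (of (.σ r) * of (.σ s))
  | S_add (p q : P) : Rel (of (.S (p + q))) (of (.S p) + of (.S q))
  | T_add (p q : Q) : Rel (of (.T (p + q))) (of (.T p) + of (.T q))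
  | S_ract (p : P) (r : R) : Rel (of (.S (Bimodule.ract p r))) (of (.S p) * of (.σ r))
  | S_lact (r : R) (p : P) : Rel (of (.S (Bimodule.lact r p))) (of (.σ r) * of (.S p))
  | T_ract (q : Q) (r : R) : Rel (of (.T (Bimodule.ract q r))) (of (.T q) * of (.σ r))
  | T_lact (r : R) (q : Q) : Rel (of (.T (Bimodule.lact r q))) (of (.σ r) * of (.T q))
  | covariant (p : P) (q : Q) :
      Rel (of (.σ (ψ.toAddMonoidHom (BTensor.tmul R p q)))) (of (.S p) * of (.T q))

/-- The unital ring generated by a covariant representation. -/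
abbrev Unital : Type (max u v w) := (ringConGen (Rel ψ)).Quotient

/-- The images of the generators. -/
def gen (g : Gen R P Q) : Unital ψ := (ringConGen (Rel ψ)).mk' (FreeRing.of g)

theorem rel_eq {a b : FreeRing (Gen R P Q)} (h : Rel ψ a b) :
    (ringConGen (Rel ψ)).mk' a = (ringConGen (Rel ψ)).mk' b :=
  (RingCon.eq _).2 (RingConGen.Rel.of _ _ h)

end

end ToeplitzRing

open ToeplitzRing in
/-- The Toeplitz ring of an `R`-system: the subring (without unit) generated by the generators of
`ToeplitzRing.Unital`. -/
def ToeplitzRing {R : Type u} [NonUnitalRing R] {P : Type v} [AddCommGroup P] [Bimodule R P]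
    {Q : Type w} [AddCommGroup Q] [Bimodule R Q] (ψ : BimoduleHom R (BTensor R P Q) R) :
    Type (max u v w) :=
  NonUnitalSubring.closure (Set.range (gen ψ))

namespace ToeplitzRing

open CovariantRep

variable {R : Type u} [NonUnitalRing R] {P : Type v} [AddCommGroup P] [Bimodule R P]
    {Q : Type w} [AddCommGroup Q] [Bimodule R Q] (ψ : BimoduleHom R (BTensor R P Q) R)

instance : NonUnitalRing (ToeplitzRing ψ) :=
  inferInstanceAs (NonUnitalRing (NonUnitalSubring.closure (Set.range (gen ψ))))

/-- The inclusion of the Toeplitz ring into the unital ring. -/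
def incl : ToeplitzRing ψ →ₙ+* Unital ψ :=
  NonUnitalSubringClass.subtype (NonUnitalSubring.closure (Set.range (gen ψ)))

theorem incl_injective : Function.Injective (incl ψ) := Subtype.val_injective

/-- A generator as an element of the Toeplitz ring. -/
def ofGen (g : Gen R P Q) : ToeplitzRing ψ :=
  ⟨gen ψ g, NonUnitalSubring.subset_closure ⟨g, rfl⟩⟩

theorem incl_ofGen (g : Gen R P Q) : incl ψ (ofGen ψ g) = gen ψ g := rfl

theorem ofGen_eq_add {g h k : Gen R P Q}
    (H : Rel ψ (FreeRing.of g) (FreeRing.of h + FreeRing.of k)) :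
    ofGen ψ g = ofGen ψ h + ofGen ψ k :=
  incl_injective ψ <| by
    rw [map_add, incl_ofGen, incl_ofGen, incl_ofGen, gen, rel_eq ψ H, map_add]; rfl

theorem ofGen_eq_mul {g h k : Gen R P Q}
    (H : Rel ψ (FreeRing.of g) (FreeRing.of h * FreeRing.of k)) :
    ofGen ψ g = ofGen ψ h * ofGen ψ k :=
  incl_injective ψ <| by
    rw [map_mul, incl_ofGen, incl_ofGen, incl_ofGen, gen, rel_eq ψ H, map_mul]; rfl

/-- The universal covariant representation. -/
def rep : CovariantRep ψ (ToeplitzRing ψ) where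
  S := AddMonoidHom.mk' (fun p => ofGen ψ (.S p)) fun p q => ofGen_eq_add ψ (.S_add p q)
  T := AddMonoidHom.mk' (fun p => ofGen ψ (.T p)) fun p q => ofGen_eq_add ψ (.T_add p q)
  σ :=
    { AddMonoidHom.mk' (fun p => ofGen ψ (.σ p)) fun p q => ofGen_eq_add ψ (.σ_add p q) with
      map_mul' := fun p q => ofGen_eq_mul ψ (.σ_mul p q) }
  S_ract p r := ofGen_eq_mul ψ (.S_ract p r)
  S_lact p r := ofGen_eq_mul ψ (.S_lact p r)
  T_ract p r := ofGen_eq_mul ψ (.T_ract p r)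
  T_lact p r := ofGen_eq_mul ψ (.T_lact p r)
  covariant p q := ofGen_eq_mul ψ (.covariant p q)

theorem rep_isSurjective : (rep ψ).IsSurjective := by
  have hset : Set.range (rep ψ).σ ∪ Set.range (rep ψ).T ∪ Set.range (rep ψ).S =
      Set.range (ofGen ψ) := by
    ext a
    constructor
    · rintro ((⟨r, rfl⟩ | ⟨q, rfl⟩) | ⟨p, rfl⟩) <;> exact ⟨_, rfl⟩
    · rintro ⟨r | p | q, rfl⟩
      exacts [.inl (.inl ⟨r, rfl⟩), .inr ⟨p, rfl⟩, .inl (.inr ⟨q, rfl⟩)]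
  rw [IsSurjective, hset]
  refine eq_top_iff.2 fun a _ => ?_
  -- Here the closure taken inside the Toeplitz ring is compared with the closure in `Unital ψ` that
  -- defines it.
  have hle : NonUnitalSubring.closure (Set.range (gen ψ)) ≤
      (NonUnitalSubring.closure (Set.range (ofGen ψ))).map (incl ψ) := by
    rw [NonUnitalSubring.closure_le]
    rintro _ ⟨g, rfl⟩
    exact ⟨ofGen ψ g, NonUnitalSubring.subset_closure ⟨g, rfl⟩, rfl⟩
  obtain ⟨b, hb, hba⟩ := hle a.2
  rwa [← incl_injective ψ hba]

section Lift

variable {ψ}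

variable {B : Type x} [NonUnitalRing B] (ρ : CovariantRep ψ B)

/-- The values of a representation on the generators. -/
def genLift : Gen R P Q → B
  | .σ r => ρ.σ r
  | .S p => ρ.S p
  | .T q => ρ.T q

/-- The homomorphism on the unital ring into the unitization of `B`. -/
def unitalLift : Unital ψ →+* IntUnitization B :=
  (ringConGen (Rel ψ)).lift (FreeRing.lift fun g => IntUnitization.incl B (genLift ρ g)) <| by
    refine RingCon.ringConGen_le.2 fun a b h => ?_
    rw [RingCon.ker_apply]
    cases h <;>
      simp only [map_add, map_mul, FreeRing.lift_of, genLift, ρ.S_ract, ρ.S_lact, ρ.T_ract,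
        ρ.T_lact, ρ.covariant]

theorem unitalLift_gen (g : Gen R P Q) :
    unitalLift ρ (gen ψ g) = IntUnitization.incl B (genLift ρ g) :=
  FreeRing.lift_of _ g

/-- The copy of `B` in its unitization is a subring containing the images of all generators, so the
lift has no integer part on the Toeplitz ring. -/
theorem exists_incl_eq (a : ToeplitzRing ψ) :
    ∃ b, IntUnitization.incl B b = unitalLift ρ (incl ψ a) := by
  induction a using (rep_isSurjective ψ).induction with
  | hσ r => exact ⟨_, (unitalLift_gen ρ (.σ r)).symm⟩
  | hT r => exact ⟨_, (unitalLift_gen ρ (.T r)).symm⟩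
  | hS r => exact ⟨_, (unitalLift_gen ρ (.S r)).symm⟩
  | hz => exact ⟨0, by simp only [map_zero]⟩
  | hadd a b ha hb =>
    obtain ⟨x, hx⟩ := ha
    obtain ⟨y, hy⟩ := hb
    exact ⟨x + y, by simp only [map_add, hx, hy]⟩
  | hneg a ha =>
    obtain ⟨x, hx⟩ := ha
    exact ⟨-x, by simp only [map_neg, hx]⟩
  | hmul a b ha hb =>
    obtain ⟨x, hx⟩ := ha
    obtain ⟨y, hy⟩ := hb
    exact ⟨x * y, by simp only [map_mul, hx, hy]⟩

/-- The value at `a` of the homomorphism induced by a covariant representation. -/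
noncomputable def liftFun (a : ToeplitzRing ψ) : B := (exists_incl_eq ρ a).choose

theorem incl_liftFun (a : ToeplitzRing ψ) :
    IntUnitization.incl B (liftFun ρ a) = unitalLift ρ (incl ψ a) :=
  (exists_incl_eq ρ a).choose_spec

/-- The homomorphism from the Toeplitz ring induced by a covariant representation. -/
noncomputable def lift : ToeplitzRing ψ →ₙ+* B where
  toFun := liftFun ρ
  map_zero' := IntUnitization.incl_injective <| by simp only [incl_liftFun, map_zero]
  map_add' a b := IntUnitization.incl_injective <| by simp only [incl_liftFun, map_add]
  map_mul' a b := IntUnitization.incl_injective <| by simp only [incl_liftFun, map_mul]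

theorem lift_ofGen (g : Gen R P Q) : lift ρ (ofGen ψ g) = genLift ρ g :=
  IntUnitization.incl_injective <| (incl_liftFun ρ _).trans (unitalLift_gen ρ g)

theorem lift_isMorphism : IsMorphism (rep ψ) ρ (lift ρ) where
  comp_T q := lift_ofGen ρ (.T q)
  comp_S q := lift_ofGen ρ (.S q)
  comp_σ q := lift_ofGen ρ (.σ q)

theorem rep_isUniversal : IsUniversal.{u, v, w, x, max u v w} (rep ψ) := fun _ _ ρ =>
  ⟨lift ρ, lift_isMorphism ρ, fun _ hη => (rep_isSurjective ψ).hom_eq hη (lift_isMorphism ρ)⟩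

end Lift

end ToeplitzRing

/-! ### The Fock representation -/

namespace Fock

variable {R : Type u} [NonUnitalRing R]

/-- The unitization of `R` with left multiplication by `R` and zero right multiplication. -/
def base (R : Type u) [NonUnitalRing R] : Type (max u w) := ULift.{w} (IntUnitization R)

instance : AddCommGroup (base.{u, w} R) :=
  inferInstanceAs (AddCommGroup (ULift.{w} (IntUnitization R)))

/-- The adjoined unit makes the left action faithful, which left multiplication of `R` on itself
need not be. `base` only ever stands as the right tensor factor, where balancing uses its left
action alone, so the right action may be zero. -/
instance : Bimodule R (base.{u, w} R) where
  lact r m := ULift.up (IntUnitization.incl R r * m.down)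
  ract _ _ := 0
  lact_add r m n := congrArg ULift.up (mul_add (IntUnitization.incl R r) m.down n.down)
  add_lact r s m := congrArg ULift.up <| (congrArg (· * m.down) (map_add _ r s)).trans
    (add_mul (IntUnitization.incl R r) (IntUnitization.incl R s) m.down)
  mul_lact r s m := congrArg ULift.up <| (congrArg (· * m.down) (map_mul _ r s)).trans
    (mul_assoc (IntUnitization.incl R r) (IntUnitization.incl R s) m.down)
  add_ract _ _ _ := (add_zero _).symm
  ract_add _ _ _ := (add_zero _).symm
  ract_mul _ _ _ := rfl
  lact_ract r _ _ := congrArg ULift.up (mul_zero (IntUnitization.incl R r)).symm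

variable {P : Type v} [AddCommGroup P] [Bimodule R P] {Q : Type w} [AddCommGroup Q] [Bimodule R Q]

/-- The summands `Q ⊗ (Q ⊗ ⋯ ⊗ (Q ⊗ base))` of the Fock space. -/
def bundledLevel (R : Type u) [NonUnitalRing R] (Q : Type w) [AddCommGroup Q] [Bimodule R Q] :
    ℕ → BundledBimodule.{u, max u w} R
  | 0 => ⟨base.{u, w} R⟩
  | n + 1 => ⟨BTensor R Q (bundledLevel R Q n).carrier⟩

/-- The carrier of a summand. -/
abbrev Level (R : Type u) [NonUnitalRing R] (Q : Type w) [AddCommGroup Q] [Bimodule R Q] (n : ℕ) :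
    Type (max u w) :=
  (bundledLevel R Q n).carrier

/-- The Fock space, as a product. -/
abbrev Space (R : Type u) [NonUnitalRing R] (Q : Type w) [AddCommGroup Q] [Bimodule R Q] :
    Type (max u w) :=
  ∀ n, Level R Q n

/-- Left multiplication by `r` on the Fock space. -/
def act (Q : Type w) [AddCommGroup Q] [Bimodule R Q] (r : R) : AddMonoid.End (Space R Q) :=
  AddMonoidHom.mk' (fun f n => Bimodule.lact r (f n)) fun _ _ =>
    funext fun _ => Bimodule.lact_add _ _ _

/-- The creation operator `f ↦ q ⊗ f`. -/
def create (q : Q) : AddMonoid.End (Space R Q) :=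
  AddMonoidHom.mk'
    (fun f n => match n with
      | 0 => 0
      | n + 1 => (BTensor.tmul R q (f n) : BTensor R Q (Level R Q n)))
    fun _ _ => funext fun n => match n with
      | 0 => (add_zero _).symm
      | _ + 1 => BTensor.tmul_add _ _ _

/-- The map `q ⊗ m ↦ ψ(p ⊗ q) m`. -/
def contract (ψ : BimoduleHom R (BTensor R P Q) R) (M : Type y) [AddCommGroup M] [Bimodule R M]
    (p : P) : BTensor R Q M →+ M :=
  BTensor.lift
    (AddMonoidHom.mk'
      (fun q => Bimodule.lactHom M (ψ.toAddMonoidHom (BTensor.tmul R p q)))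
      fun q q' => by
        ext m
        rw [BTensor.tmul_add, map_add]
        exact Bimodule.add_lact _ _ _)
    fun q r m => by
      change Bimodule.lact (ψ.toAddMonoidHom (BTensor.tmul R p (Bimodule.ract q r))) m =
        Bimodule.lact (ψ.toAddMonoidHom (BTensor.tmul R p q)) (Bimodule.lact r m)
      rw [← Bimodule.mul_lact]
      -- Balancedness is the right linearity of `ψ`.
      exact congrArg (Bimodule.lact · m) (ψ.map_ract (BTensor.tmul R p q) r)

theorem contract_tmul (ψ : BimoduleHom R (BTensor R P Q) R) (M : Type y) [AddCommGroup M]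
    [Bimodule R M] (p : P) (q : Q) (m : M) :
    contract ψ M p (BTensor.tmul R q m) =
      Bimodule.lact (ψ.toAddMonoidHom (BTensor.tmul R p q)) m := rfl

/-- The annihilation operator `q ⊗ f ↦ ψ(p ⊗ q) f`. -/
def annihilate (ψ : BimoduleHom R (BTensor R P Q) R) (p : P) : AddMonoid.End (Space R Q) :=
  AddMonoidHom.mk' (fun f n => contract ψ (Level R Q n) p (f (n + 1))) fun _ _ =>
    funext fun _ => map_add _ _ _

/-- The Fock representation. -/
def rep (ψ : BimoduleHom R (BTensor R P Q) R) : CovariantRep ψ (AddMonoid.End (Space R Q)) where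
  S := AddMonoidHom.mk' (annihilate ψ) fun p p' => by
    ext f n
    exact BTensor.hom_ext_apply (contract ψ (Level R Q n) (p + p'))
      (contract ψ (Level R Q n) p + contract ψ (Level R Q n) p') (fun q m => by
        rw [AddMonoidHom.add_apply, contract_tmul, contract_tmul, contract_tmul,
          BTensor.add_tmul, map_add, Bimodule.add_lact]) (f (n + 1))
  T := AddMonoidHom.mk' create fun q q' => by
    ext f n
    cases n with
    | zero => exact (add_zero _).symm
    | succ n => exact BTensor.add_tmul _ _ _
  σ :=
    { AddMonoidHom.mk' (act Q) fun r s => by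
        ext f n
        exact Bimodule.add_lact _ _ _ with
      map_mul' := fun r s => by
        ext f n
        exact Bimodule.mul_lact _ _ _ }
  S_ract p r := by
    ext f n
    exact BTensor.hom_ext_apply (contract ψ (Level R Q n) (Bimodule.ract p r))
      ((contract ψ (Level R Q n) p).comp (BTensor.lactMap R Q (Level R Q n) r)) (fun q m => by
        rw [AddMonoidHom.comp_apply, BTensor.lactMap_tmul, contract_tmul, contract_tmul,
          BTensor.ract_tmul]) (f (n + 1))
  S_lact r p := by
    ext f n
    exact BTensor.hom_ext_apply (contract ψ (Level R Q n) (Bimodule.lact r p))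
      ((Bimodule.lactHom (Level R Q n) r).comp (contract ψ (Level R Q n) p)) (fun q m => by
        rw [AddMonoidHom.comp_apply, contract_tmul, contract_tmul]
        exact (congrArg (Bimodule.lact · m) (ψ.map_lact r (BTensor.tmul R p q))).trans
          (Bimodule.mul_lact _ _ _)) (f (n + 1))
  T_ract q r := by
    ext f n
    cases n with
    | zero => rfl
    | succ n => exact BTensor.ract_tmul _ _ _
  T_lact r q := by
    ext f n
    cases n with
    | zero => exact (map_zero (Bimodule.lactHom _ r)).symm
    | succ n => rfl
  -- Creation raises the index by one and annihilation lowers it again, which leaves ψ(p ⊗ q) acting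
  -- on each coordinate.
  covariant p q := rfl

/-- The vector `1` in the summand of index `0`. -/
def vacuum (R : Type u) [NonUnitalRing R] (Q : Type w) [AddCommGroup Q] [Bimodule R Q] :
    Space R Q
  | 0 => (⟨1⟩ : base.{u, w} R)
  | _ + 1 => 0

/-- The operator of `r` sends the vacuum to a vector with coordinate `r * 1 = r` at index 0. -/
theorem rep_isInjective (ψ : BimoduleHom R (BTensor R P Q) R) : (rep ψ).IsInjective := by
  intro r s h
  have h₀ : IntUnitization.incl R r * 1 = IntUnitization.incl R s * 1 :=
    congrArg (fun F : AddMonoid.End (Space R Q) =>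
      (F (vacuum R Q) 0 : base.{u, w} R).down) h
  rw [mul_one, mul_one] at h₀
  exact IntUnitization.incl_injective h₀

end Fock

/-! ### Injectivity of the universal representation -/

namespace ToeplitzRing

open CovariantRep

variable {R : Type u} [NonUnitalRing R] {P : Type v} [AddCommGroup P] [Bimodule R P]
    {Q : Type w} [AddCommGroup Q] [Bimodule R Q] (ψ : BimoduleHom R (BTensor R P Q) R)

theorem rep_isInjective : (rep ψ).IsInjective := by
  intro r s h
  apply Fock.rep_isInjective ψ
  rw [← (lift_isMorphism (Fock.rep ψ)).comp_σ, h, (lift_isMorphism (Fock.rep ψ)).comp_σ]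

/-! ### The grading -/

variable {ψ}

/-- The element `a` in degree `s` of the semigroup ring. -/
noncomputable def homog (s : SIndex) (a : ToeplitzRing ψ) :
    MonoidAlgebra (IntUnitization (ToeplitzRing ψ)) SIndex :=
  MonoidAlgebra.single s (IntUnitization.incl _ a)

theorem homog_add (s : SIndex) (a b : ToeplitzRing ψ) :
    homog s (a + b) = homog s a + homog s b := by
  rw [homog, map_add, MonoidAlgebra.single_add]; rfl

theorem homog_mul (s t : SIndex) (a b : ToeplitzRing ψ) :
    homog s a * homog t b = homog (s * t) (a * b) := by
  rw [homog, homog, MonoidAlgebra.single_mul_single, ← map_mul]; rfl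

variable (ψ)

/-- The representation `σ ↦ σ · (0,0)`, `T ↦ T · (1,0)`, `S ↦ S · (0,1)` on the semigroup ring. -/
noncomputable def gradedRep :
    CovariantRep ψ (MonoidAlgebra (IntUnitization (ToeplitzRing ψ)) SIndex) where
  S := AddMonoidHom.mk' (fun p => homog ⟨0, 1⟩ ((rep ψ).S p)) fun p q => by
    rw [map_add, homog_add]
  T := AddMonoidHom.mk' (fun p => homog ⟨1, 0⟩ ((rep ψ).T p)) fun p q => by
    rw [map_add, homog_add]
  σ :=
    { AddMonoidHom.mk' (fun p => homog ⟨0, 0⟩ ((rep ψ).σ p)) fun p q => by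
        rw [map_add, homog_add] with
      map_mul' := fun p q => by
        change homog _ _ = homog _ _ * homog _ _
        rw [homog_mul, map_mul]; rfl }
  S_ract p r := by
    change homog _ _ = homog _ _ * homog _ _
    rw [homog_mul, (rep ψ).S_ract]; rfl
  S_lact r p := by
    change homog _ _ = homog _ _ * homog _ _
    rw [homog_mul, (rep ψ).S_lact]; rfl
  T_ract p r := by
    change homog _ _ = homog _ _ * homog _ _
    rw [homog_mul, (rep ψ).T_ract]; rfl
  T_lact r p := by
    change homog _ _ = homog _ _ * homog _ _
    rw [homog_mul, (rep ψ).T_lact]; rfl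
  -- The degrees match because (0,1)(1,0) = (0,0) in 𝒮.
  covariant p q := by
    change homog _ _ = homog _ _ * homog _ _
    rw [homog_mul, (rep ψ).covariant]; rfl

/-- The elements that are homogeneous of degree `s` under `lift (gradedRep ψ)`. -/
noncomputable def degree (s : SIndex) : AddSubgroup (ToeplitzRing ψ) :=
  AddMonoidHom.eqLocus
    (lift (gradedRep ψ) : ToeplitzRing ψ →+
      MonoidAlgebra (IntUnitization (ToeplitzRing ψ)) SIndex)
    (AddMonoidHom.mk' (homog s) (homog_add s))

theorem mem_degree {s : SIndex} {a : ToeplitzRing ψ} :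
    a ∈ degree ψ s ↔ lift (gradedRep ψ) a = homog s a := Iff.rfl

theorem degree_mul_mem (s t : SIndex) (a b : ToeplitzRing ψ) (ha : a ∈ degree ψ s)
    (hb : b ∈ degree ψ t) : a * b ∈ degree ψ (s * t) := by
  rw [mem_degree] at *
  rw [map_mul, ha, hb, homog_mul]

/-- The coefficient at `s` of the image in the semigroup ring vanishes on every other degree, while
on degree `s` it returns the element itself. -/
theorem iSupIndep_degree : iSupIndep (degree ψ) := by
  refine iSupIndep_def.2 fun s => AddSubgroup.disjoint_def.2 fun {a} ha hsup => ?_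
  let coord : ToeplitzRing ψ →+ IntUnitization (ToeplitzRing ψ) :=
    AddMonoidHom.mk' (fun a => (lift (gradedRep ψ) a).coeff s) fun a b => by
      rw [map_add]; rfl
  have hker : (⨆ (t) (_ : t ≠ s), degree ψ t) ≤ coord.ker := by
    refine iSup₂_le fun t hts b hb => ?_
    rw [mem_degree] at hb
    change (lift (gradedRep ψ) b).coeff s = 0
    rw [hb]
    exact Finsupp.single_eq_of_ne hts.symm
  have h₁ : (lift (gradedRep ψ) a).coeff s = 0 := hker hsup
  rw [(mem_degree ψ).1 ha] at h₁
  have h₂ : IntUnitization.incl _ a = 0 := Eq.trans Finsupp.single_eq_same.symm h₁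
  exact IntUnitization.incl_injective (h₂.trans (map_zero (IntUnitization.incl _)).symm)

/-- Independence is clear for `degree` and spanning for the components; equality gives each family
both properties. -/
theorem degree_eq_component : degree ψ = (rep ψ).component :=
  (iSupIndep_degree ψ).eq_of_le_of_iSup_eq_top
    (component_le (degree_mul_mem ψ) (lift_isMorphism (gradedRep ψ)).comp_σ
      (lift_isMorphism (gradedRep ψ)).comp_T (lift_isMorphism (gradedRep ψ)).comp_S)
    (rep_isSurjective ψ).iSup_component

theorem isSGrading_component : IsSGrading (rep ψ).component where
  isInternal := by
    rw [← degree_eq_component]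
    refine ⟨(iSupIndep_degree ψ).dfinsuppSumAddHom_injective, fun a => ?_⟩
    have ha : a ∈ ⨆ s, degree ψ s := by
      rw [degree_eq_component, (rep_isSurjective ψ).iSup_component]; trivial
    have hle : ⨆ s, degree ψ s ≤ (DirectSum.coeAddMonoidHom (degree ψ)).range :=
      iSup_le fun s b hb => ⟨DirectSum.of _ s ⟨b, hb⟩, DirectSum.coeAddMonoidHom_of _ _ _⟩
    exact hle ha
  mul_mem := by
    rw [← degree_eq_component]
    exact degree_mul_mem ψ

end ToeplitzRing

/-! ### The main theorem -/

theorem theorem1 {R : Type u} [NonUnitalRing R]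
    {P : Type v} [AddCommGroup P] [Bimodule R P] {Q : Type w} [AddCommGroup Q] [Bimodule R Q]
    (ψ : BimoduleHom R (BTensor R P Q) R) :
    ∃ (A : Type (max u v w)) (_ : NonUnitalRing A) (τ : CovariantRep ψ A),
      τ.IsInjective ∧ τ.IsSurjective ∧
      -- the universal property, for test rings in `Type (max u v w)` and in every other universe
      CovariantRep.IsUniversal.{u, v, w, max u v w, max u v w} τ ∧ CovariantRep.IsUniversal.{u, v, w, x, max u v w} τ ∧
      -- uniqueness up to isomorphism
      (∀ (B : Type x) [NonUnitalRing B] (ρ : CovariantRep ψ B), ρ.IsSurjective →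
        CovariantRep.IsUniversal.{u, v, w, max u v w, x} ρ →
        ∃ φ : B →ₙ+* A, CovariantRep.IsIsomorphism ρ τ φ) ∧
      (∀ (B : Type x) [NonUnitalRing B] (ρ : CovariantRep ψ B), ρ.IsSurjective →
        ∀ φ : B →ₙ+* A, CovariantRep.IsMorphism ρ τ φ → CovariantRep.IsIsomorphism ρ τ φ) ∧
      -- the grading and its uniqueness
      IsSGrading τ.component ∧
      (∀ 𝒴 : SIndex → AddSubgroup A, IsSGrading 𝒴 →
        (∀ r : R, τ.σ r ∈ 𝒴 ⟨0, 0⟩) → (∀ q : Q, τ.T q ∈ 𝒴 ⟨1, 0⟩) →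
        (∀ p : P, τ.S p ∈ 𝒴 ⟨0, 1⟩) → 𝒴 = τ.component) := by
  let τ := ToeplitzRing.rep ψ
  have hsurj : τ.IsSurjective := ToeplitzRing.rep_isSurjective ψ
  have hiso : ∀ (B : Type x) [NonUnitalRing B] (ρ : CovariantRep ψ B), ρ.IsSurjective →
      ∀ φ : B →ₙ+* ToeplitzRing ψ, CovariantRep.IsMorphism ρ τ φ →
        CovariantRep.IsIsomorphism ρ τ φ := fun B _ ρ hρ φ hφ =>
    -- The inverse is the homomorphism that the universal property of `τ` attaches to `ρ`.
    hφ.isIsomorphism hρ hsurj (ToeplitzRing.lift_isMorphism ρ)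
  refine ⟨ToeplitzRing ψ, inferInstance, τ, ToeplitzRing.rep_isInjective ψ, hsurj,
    ToeplitzRing.rep_isUniversal, ToeplitzRing.rep_isUniversal, fun B _ ρ hρ huniv => ?_, hiso,
    ToeplitzRing.isSGrading_component ψ, fun 𝒴 h𝒴 hσ hT hS => ?_⟩
  · obtain ⟨φ, hφ, -⟩ := huniv (ToeplitzRing ψ) τ
    exact ⟨φ, hiso B ρ hρ φ hφ⟩
  -- Any such grading contains the components by minimality and is independent, so the spanning
  -- components fill it.
  · exact h𝒴.isInternal.addSubgroup_iSupIndep.eq_of_le_of_iSup_eq_top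
      (CovariantRep.component_le h𝒴.mul_mem hσ hT hS) hsurj.iSup_component
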